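/- A topological group $G$ is said to have the Lévy property (to be a Lévy group) if there is an increasing sequence $K_0\subseteq K_1\subseteq\cdots$ of compact subgroups of $G$, with normalized Haar measures $\mu_i$ on $K_i$ (regarded as Borel measures on $G$), such that $\bigcup_i K_i$ is dense in $G$ and, for every open neighborhood $V$ of the identity and every sequence of Borel sets $A_i\subseteq K_i$ with $\liminf_i\mu_i(A_i)>0$, one has $\lim_i\mu_i(VA_i)=1$. A topological group is non-Archimedean if its identity has a neighborhood basis consisting of open subgroups, and Polish if it is separable and completely metrizable. Corollary. No nontrivial non-Archimedean Polish group has the Lévy property. Equivalently: no nontrivial closed subgroup of $S_\infty$ has the Lévy property, where $S_\infty$ is the group of all permutations of $\mathbb N$ with the topology of pointwise convergence ($\mathbb N$ being discrete); and no nontrivial automorphism group of a countable first-order structure, with the topology of pointwise convergence (the underlying countable set being discrete), has the Lévy property. -/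

import Mathlib

universe u v w z

open MeasureTheory Filter Topology
open scoped Pointwise

/-- The normalized Haar measure of a compact subgroup `K` of `G`, regarded as a Borel measure
on `G`: the push-forward along the inclusion `K → G` of the Haar measure on `K` of total mass `1`. -/
noncomputable def normalizedHaar {G : Type*} [Group G] [TopologicalSpace G] [IsTopologicalGroup G]
    [MeasurableSpace G] [BorelSpace G] (K : Subgroup G) [CompactSpace K] : Measure G :=
  Measure.map (Subtype.val : K → G)
    (Measure.haarMeasure (⊤ : TopologicalSpace.PositiveCompacts K))

/-- The sequence `K` of compact subgroups of `G` is a witnessing sequence for the Lévy property. -/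
def IsLevyWitness {G : Type*} [Group G] [TopologicalSpace G] [IsTopologicalGroup G]
    [MeasurableSpace G] [BorelSpace G] (K : ℕ → Subgroup G) [∀ i, CompactSpace (K i)] : Prop :=
  Monotone K ∧
  Dense (⋃ i, (K i : Set G)) ∧
  ∀ V : Set G, IsOpen V → (1 : G) ∈ V →
    ∀ A : ℕ → Set G, (∀ i, A i ⊆ K i) → (∀ i, MeasurableSet (A i)) →
      0 < liminf (fun i => normalizedHaar (K i) (A i)) atTop →
      Tendsto (fun i => normalizedHaar (K i) (V * A i)) atTop (𝓝 1)

/-- The Lévy property of a topological group, which carries its Borel σ-algebra. -/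
def HasLevyProperty (G : Type*) [Group G] [TopologicalSpace G] [IsTopologicalGroup G] : Prop :=
  letI : MeasurableSpace G := borel G
  haveI : BorelSpace G := ⟨rfl⟩
  ∃ (K : ℕ → Subgroup G) (_ : ∀ i, CompactSpace (K i)), IsLevyWitness K

/-- The topology of pointwise convergence on the group of all permutations of `X`,
where `X` is discrete. -/
instance permPointwiseTopology (X : Type*) : TopologicalSpace (Equiv.Perm X) :=
  TopologicalSpace.induced (fun f : Equiv.Perm X => (f : X → X))
    (@Pi.topologicalSpace X (fun _ => X) (fun _ => ⊥))

theorem isOpen_perm_apply_eq {X : Type*} (x y : X) : IsOpen {f : Equiv.Perm X | f x = y} := by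
  let _ : TopologicalSpace X := ⊥
  have _ : DiscreteTopology X := ⟨rfl⟩
  have h : Continuous (fun f : Equiv.Perm X => (f : X → X)) := continuous_induced_dom
  exact (isOpen_discrete {y}).preimage ((continuous_apply x).comp h)

theorem continuous_perm_iff {X Y : Type*} [TopologicalSpace Y] (F : Y → Equiv.Perm X) :
    Continuous F ↔ ∀ x y : X, IsOpen {t : Y | F t x = y} := by
  refine ⟨fun h x y => (isOpen_perm_apply_eq x y).preimage h, fun h => ?_⟩
  let _ : TopologicalSpace X := ⊥
  have _ : DiscreteTopology X := ⟨rfl⟩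
  refine continuous_induced_rng.2 (continuous_pi fun x => ?_)
  exact continuous_discrete_rng.2 fun y => h x y

instance permIsTopologicalGroup (X : Type*) : IsTopologicalGroup (Equiv.Perm X) where
  continuous_mul := by
    refine (continuous_perm_iff _).2 fun x y => ?_
    have : {t : Equiv.Perm X × Equiv.Perm X | (t.1 * t.2) x = y}
        = ⋃ z : X, {f : Equiv.Perm X | f z = y} ×ˢ {f : Equiv.Perm X | f x = z} := by
      ext t
      simp
    rw [this]
    exact isOpen_iUnion fun z => (isOpen_perm_apply_eq z y).prod (isOpen_perm_apply_eq x z)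
  continuous_inv := by
    refine (continuous_perm_iff _).2 fun x y => ?_
    have : {t : Equiv.Perm X | t⁻¹ x = y} = {t : Equiv.Perm X | t y = x} := by
      ext t
      simp only [Set.mem_ofPred_eq, Equiv.Perm.inv_eq_iff_eq]
      exact eq_comm
    rw [this]
    exact isOpen_perm_apply_eq y x

/-- The automorphism group of a first-order structure `M`, as a group of permutations of `M`;
it inherits the topology of pointwise convergence. -/
def structureAut (L : FirstOrder.Language) (M : Type*) [L.Structure M] :
    Subgroup (Equiv.Perm M) where
  carrier := {f | ∃ g : L.Equiv M M, g.toEquiv = f}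
  one_mem' := ⟨FirstOrder.Language.Equiv.refl L M, rfl⟩
  mul_mem' := by
    rintro _ _ ⟨g, rfl⟩ ⟨h, rfl⟩
    exact ⟨g.comp h, rfl⟩
  inv_mem' := by
    rintro _ ⟨g, rfl⟩
    exact ⟨g.symm, rfl⟩

/-! A proper open subgroup `U` is itself a neighborhood `V` violating the Lévy condition. If `K i`
is not contained in `U`, then `U ∩ K i` has finite index at least 2 in `K i`, and about half of its
right cosets form a set `A i` of measure between 1/3 and 1/2. Multiplying by `U` on the left adds
nothing to `A i` inside `K i`, so the measures cannot tend to 1. Proper open subgroups come from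
separating 1 from another point, or from stabilizing a moved point. -/

/-- Conjugation is a continuous surjective endomorphism of a compact group, so it preserves Haar
measure; right translation is conjugation followed by left translation. -/
theorem isMulRightInvariant_of_isHaarMeasure_of_compactSpace {K : Type*} [Group K]
    [TopologicalSpace K] [IsTopologicalGroup K] [CompactSpace K] [MeasurableSpace K]
    [BorelSpace K] (μ : Measure K) [μ.IsHaarMeasure] : μ.IsMulRightInvariant := by
  refine ⟨fun g => ?_⟩
  have hconj : MeasurePreserving (MulAut.conj g⁻¹).toMonoidHom μ μ :=
    MonoidHom.measurePreserving
      (by change Continuous fun x => g⁻¹ * x * g⁻¹⁻¹; fun_prop)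
      (MulAut.conj g⁻¹).surjective rfl
  convert ((measurePreserving_mul_left μ g).comp hconj).map_eq using 2
  ext x
  simp [mul_assoc]

theorem exists_isClopen_mul_eq_measure_between {K : Type*} [Group K] [TopologicalSpace K]
    [IsTopologicalGroup K] [CompactSpace K] [MeasurableSpace K] [BorelSpace K] (μ : Measure K)
    [IsProbabilityMeasure μ] [μ.IsMulRightInvariant]
    (U : Subgroup K) (hU : IsOpen (U : Set K)) (hne : U ≠ ⊤) :
    ∃ A : Set K, IsClopen A ∧ (∀ u ∈ U, ∀ a ∈ A, u * a ∈ A) ∧ 1 / 3 ≤ μ A ∧ μ A ≤ 1 / 2 := by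
  classical
  have hfin : Finite (K ⧸ U) := U.quotient_finite_of_isOpen hU
  have hdisc : DiscreteTopology (K ⧸ U) := QuotientGroup.discreteTopology hU
  have := Fintype.ofFinite (K ⧸ U)
  let q : K → K ⧸ U := QuotientGroup.mk
  have hq : Continuous q := QuotientGroup.continuous_mk
  have hcard : 1 < Fintype.card (K ⧸ U) := by
    rw [← Nat.card_eq_fintype_card]
    have h0 : U.index ≠ 0 := Subgroup.index_ne_zero_of_finite
    have h1 : U.index ≠ 1 := fun h => hne (Subgroup.index_eq_one.1 h)
    change 1 < U.index
    omega
  -- `K ⧸ U` consists of left cosets, whereas right cosets are wanted: the count uses the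
  -- left-invariant `μ.inv`, and inversion is undone at the end.
  have hfiber : ∀ c, μ.inv (q ⁻¹' {c}) = μ.inv (q ⁻¹' {q 1}) := by
    intro c
    obtain ⟨g, rfl⟩ := QuotientGroup.mk_surjective c
    rw [← measure_preimage_mul μ.inv g (q ⁻¹' {(QuotientGroup.mk g : K ⧸ U)})]
    congr 1
    ext k
    simp [q, QuotientGroup.eq]
  have hmeas : ∀ S : Finset (K ⧸ U), μ.inv (q ⁻¹' S) = S.card * μ.inv (q ⁻¹' {q 1}) := by
    intro S
    rw [← sum_measure_preimage_singleton S
      fun c _ => ((isOpen_discrete {c}).preimage hq).measurableSet]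
    simp [hfiber]
  have htot : (Fintype.card (K ⧸ U) : ENNReal) * μ.inv (q ⁻¹' {q 1}) = 1 := by
    have h := hmeas Finset.univ
    rw [Finset.card_univ] at h
    rw [← h, Finset.coe_univ, Set.preimage_univ, Measure.inv_apply, Set.inv_univ, measure_univ]
  -- For `n ≥ 2`, `n ≤ 3 * (n / 2)`, with equality at `n = 3`; hence the bound 1/3.
  obtain ⟨S, -, hS⟩ := Finset.exists_subset_card_eq
    (s := (Finset.univ : Finset (K ⧸ U))) (n := Fintype.card (K ⧸ U) / 2)
    (by rw [Finset.card_univ]; omega)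
  have hA : μ (q ⁻¹' S)⁻¹ = S.card * μ.inv (q ⁻¹' {q 1}) := by
    rw [← Measure.inv_apply, hmeas]
  refine ⟨(q ⁻¹' S)⁻¹, ((isClopen_discrete (S : Set (K ⧸ U))).preimage hq).preimage continuous_inv,
    ?_, ?_, ?_⟩
  · intro u hu a ha
    have h : q (u * a)⁻¹ = q a⁻¹ := by
      simp [q, hu]
    simpa only [Set.mem_inv, Set.mem_preimage, h] using ha
  · rw [hA]
    refine ENNReal.div_le_of_le_mul ?_
    rw [← htot, mul_right_comm]
    gcongr
    exact_mod_cast (by omega : Fintype.card (K ⧸ U) ≤ S.card * 3)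
  · rw [hA, ENNReal.le_div_iff_mul_le (by simp) (by simp), ← htot, mul_right_comm]
    gcongr
    exact_mod_cast (by omega : S.card * 2 ≤ Fintype.card (K ⧸ U))

theorem normalizedHaar_apply {G : Type*} [Group G] [TopologicalSpace G] [IsTopologicalGroup G]
    [MeasurableSpace G] [BorelSpace G] (K : Subgroup G) [CompactSpace K] {A : Set G}
    (hA : MeasurableSet A) :
    normalizedHaar K A = Measure.haarMeasure (⊤ : TopologicalSpace.PositiveCompacts K)
      (Subtype.val ⁻¹' A) :=
  Measure.map_apply measurable_subtype_coe hA

theorem exists_subset_normalizedHaar_mul_le {G : Type*} [Group G] [TopologicalSpace G]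
    [IsTopologicalGroup G] [T2Space G] [MeasurableSpace G] [BorelSpace G] (K : Subgroup G)
    [CompactSpace K] (U : Subgroup G) (hU : IsOpen (U : Set G)) :
    ∃ A ⊆ (K : Set G), MeasurableSet A ∧ 1 / 3 ≤ normalizedHaar K A ∧
      (¬ K ≤ U → normalizedHaar K (U * A) ≤ 1 / 2) := by
  let μ := Measure.haarMeasure (⊤ : TopologicalSpace.PositiveCompacts K)
  have hμ : μ Set.univ = 1 := Measure.haarMeasure_self
  have : IsProbabilityMeasure μ := ⟨hμ⟩
  have : μ.IsMulRightInvariant := isMulRightInvariant_of_isHaarMeasure_of_compactSpace μ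
  have hK : IsClosed (K : Set G) := (isCompact_iff_compactSpace.2 ‹_›).isClosed
  by_cases h : K ≤ U
  -- Here only the lower bound matters; it keeps the liminf positive.
  · refine ⟨K, subset_rfl, hK.measurableSet, ?_, fun h' => (h' h).elim⟩
    rw [normalizedHaar_apply K hK.measurableSet]
    have : (Subtype.val : K → G) ⁻¹' K = Set.univ := by ext; simp
    rw [this, hμ]
    exact ENNReal.div_le_of_le_mul (by norm_num)
  · obtain ⟨A, hAc, hUA, hA1, hA2⟩ := exists_isClopen_mul_eq_measure_between μ (U.subgroupOf K)
      (hU.preimage continuous_subtype_val) (fun h' => h (Subgroup.subgroupOf_eq_top.1 h'))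
    have hm : MeasurableSet (Subtype.val '' A : Set G) :=
      (hK.isClosedEmbedding_subtypeVal.isClosedMap _ hAc.isClosed).measurableSet
    refine ⟨Subtype.val '' A, by rintro _ ⟨a, -, rfl⟩; exact a.2, hm, ?_, fun _ => ?_⟩
    · rwa [normalizedHaar_apply K hm, Set.preimage_image_eq _ Subtype.val_injective]
    · rw [normalizedHaar_apply K hU.mul_right.measurableSet]
      refine (measure_mono ?_).trans hA2
      -- If `k = u * a` lies in `K`, then `u = k * a⁻¹` lies in `U ∩ K`, which preserves `A`.
      rintro k ⟨u, hu, _, ⟨a, ha, rfl⟩, hk⟩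
      have hk' : u = ((k * a⁻¹ : K) : G) := by simp [← hk]
      have := hUA (k * a⁻¹) (Subgroup.mem_subgroupOf.2 (hk' ▸ hu)) a ha
      simpa using this

/-- A Hausdorff group with a proper open subgroup does not have the Lévy property. -/
theorem not_hasLevyProperty_of_isOpen_subgroup {G : Type*} [Group G] [TopologicalSpace G]
    [IsTopologicalGroup G] [T2Space G] (U : Subgroup G) (hU : IsOpen (U : Set G)) (hne : U ≠ ⊤) :
    ¬ HasLevyProperty G := by
  let _ : MeasurableSpace G := borel G
  have _ : BorelSpace G := ⟨rfl⟩
  rintro ⟨K, hK, hmono, hdense, hlim⟩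
  -- An open subgroup is closed, so a proper one cannot contain the dense union.
  obtain ⟨j, hj⟩ : ∃ j, ¬ K j ≤ U := by
    by_contra! h
    refine hne (SetLike.coe_injective ?_)
    rw [Subgroup.coe_top, ← (U.isClosed_of_isOpen hU).closure_eq]
    exact (hdense.mono (Set.iUnion_subset h)).closure_eq
  choose A hAK hAm hA1 hA2 using fun i => exists_subset_normalizedHaar_mul_le (K i) U hU
  have ht := hlim U hU U.one_mem A hAK hAm (lt_of_lt_of_le (b := 1 / 3) (by simp)
    (le_liminf_of_le (by isBoundedDefault) (Eventually.of_forall hA1)))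
  have hle : (1 : ENNReal) ≤ 1 / 2 := le_of_tendsto ht <| (eventually_ge_atTop j).mono
    fun i hi => hA2 i fun h => hj ((hmono hi).trans h)
  exact absurd hle (by simp)

instance permT2Space (X : Type*) : T2Space (Equiv.Perm X) := by
  let _ : TopologicalSpace X := ⊥
  have _ : DiscreteTopology X := ⟨rfl⟩
  exact T2Space.of_injective_continuous (f := fun f : Equiv.Perm X => (f : X → X))
    DFunLike.coe_injective continuous_induced_dom

theorem not_hasLevyProperty_subgroup_perm {X : Type*} (H : Subgroup (Equiv.Perm X))
    [Nontrivial H] : ¬ HasLevyProperty H := by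
  obtain ⟨g, hg⟩ := exists_ne (1 : H)
  obtain ⟨x, hx⟩ : ∃ x, (g : Equiv.Perm X) x ≠ x := by
    by_contra! h
    exact hg (Subtype.ext (Equiv.ext h))
  refine not_hasLevyProperty_of_isOpen_subgroup
    ((MulAction.stabilizer (Equiv.Perm X) x).subgroupOf H)
    ((isOpen_perm_apply_eq x x).preimage continuous_subtype_val) fun h => hx ?_
  exact Subgroup.mem_subgroupOf.1 (h ▸ Subgroup.mem_top g)

theorem not_hasLevyProperty_of_nonarchimedean {G : Type*} [Group G] [TopologicalSpace G]
    [NonarchimedeanGroup G] [T2Space G] [Nontrivial G] : ¬ HasLevyProperty G := by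
  obtain ⟨g, hg⟩ := exists_ne (1 : G)
  obtain ⟨U, hU⟩ := NonarchimedeanGroup.is_nonarchimedean ({g}ᶜ : Set G)
    (isOpen_compl_singleton.mem_nhds hg.symm)
  refine not_hasLevyProperty_of_isOpen_subgroup U.toSubgroup U.isOpen fun h => ?_
  exact hU (show g ∈ U.toSubgroup from h ▸ Subgroup.mem_top g) rfl

theorem mainTheorem6 :
    (∀ (G : Type u) [Group G] [TopologicalSpace G] [NonarchimedeanGroup G] [PolishSpace G]
      [Nontrivial G], ¬ HasLevyProperty G) ∧
    (∀ H : Subgroup (Equiv.Perm ℕ), IsClosed (H : Set (Equiv.Perm ℕ)) → Nontrivial H →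
      ¬ HasLevyProperty H) ∧
    (∀ (L : FirstOrder.Language.{v, w}) (M : Type z) [L.Structure M] [Countable M],
      Nontrivial (structureAut L M) → ¬ HasLevyProperty (structureAut L M)) := by
  refine ⟨?_, ?_, ?_⟩
  · intro G _ _ _ _ _
    exact not_hasLevyProperty_of_nonarchimedean
  · intro H _ _
    exact not_hasLevyProperty_subgroup_perm H
  · intro L M _ _ _
    exact not_hasLevyProperty_subgroup_perm _
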